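/- Fix the standard effective numbering $(\varphi_e)_{e\in\mathbb N}$ of the partial computable functions $\mathbb N\to\mathbb N$ and let $W_e=\operatorname{dom}(\varphi_e)$. A \emph{language} is a recursively enumerable subset of $\mathbb N$. A \emph{text} is a function $T:\mathbb N\to\mathbb N\cup\{\#\}$; its content is $\operatorname{content}(T)=\operatorname{range}(T)\setminus\{\#\}$ (and likewise for finite sequences), $T[n]=(T(0),\dots,T(n-1))$, and $\mathrm{Txt}(L)$ is the set of texts with content $L$. For a family $\mathcal S$ of subsets of $\mathbb N$ let $\mathrm{Txt}(\mathcal S)=\bigcup_{A\in\mathcal S}\mathrm{Txt}(A)$. A \emph{learner} is a partial computable function $h:\mathbb N\to\mathbb N$, applied to (codes of) finite sequences over $\mathbb N\cup\{\#\}$; on a text $T$ it produces $p(n)=h(T[n])$, and it is \emph{defined on} $T$ if $p$ is total. For total $p$ let $$\mathrm{Ex}(p,T):\Leftrightarrow\exists n_0\,\forall n\ge n_0:\ p(n)=p(n_0)\wedge W_{p(n_0)}=\operatorname{content}(T),$$ $$\mathrm{Wb}(p,T):\Leftrightarrow\forall n,m:\ \bigl(\exists k:\ n\le k\le m\wedge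 p(n)\ne p(k)\bigr)\Rightarrow\bigl(\operatorname{content}(T[m])\cap W_{p(m)}\bigr)\setminus W_{p(n)}\neq\emptyset,$$ $$\mathrm{CautTar}(p,T):\Leftrightarrow\forall n:\ \neg\bigl(\operatorname{content}(T)\subsetneq W_{p(n)}\bigr).$$ A learner satisfies such a restriction on a text $T$ if it is defined on $T$ and its sequence $p$ satisfies the restriction with $T$. For a conjunction $\delta$ of restrictions, a learner $\mathrm{TxtG}\delta$-learns a language $L$ if it satisfies $\delta$ on every $T\in\mathrm{Txt}(L)$, and it $\mathrm{TxtG}\delta$-learns a class of languages if it does so for every language of the class. \textbf{Theorem.} Let $\mathcal I$ be a set of partial computable functions which is a monoid under composition and contains all total computable functions, let $\mathcal S\subseteq\mathcal P(\mathbb N)$ be closed under subsets, and let $\mathcal L$ be a class of languages. Then the following are equivalent. (1) Some $h\in\mathcal I$ $\mathrm{TxtGWbEx}$-learns $\mathcal L$ and satisfies $\mathrm{Wb}$ also on every text in $\mathrm{Txt}(\mathcal S)$. (2) Some $h\in\mathcal I$ $\mathrm{TxtGCautTarEx}$-learns $\mathcal L$ and is defined also on every text in $\mathrm{Txt}(\mathcal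 S)$. In particular, for every total computable learner $h$ there is a total computable learner $h'$ which satisfies $\mathrm{Wb}$ on every text and which $\mathrm{TxtGWbEx}$-learns every language that $h$ $\mathrm{TxtGCautTarEx}$-learns. -/

import Mathlib

namespace InductiveInference

/-- The recursively enumerable set `W_e = dom φ_e`, where `φ_e` is the `e`-th partial computable
function in Mathlib's effective numbering by codes. -/
def W (e : ℕ) : Set ℕ :=
  {x | ((Denumerable.ofNat Nat.Partrec.Code e).eval x).Dom}

/-- The set `𝒫` of all partial computable functions on `ℕ`. -/
def partialComputable : Set (ℕ →. ℕ) := {f | Partrec f}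

/-- The set `ℛ` of all total computable functions on `ℕ`, seen as partial functions. -/
def totalComputable : Set (ℕ →. ℕ) := {f | ∃ g : ℕ → ℕ, Computable g ∧ f = (g : ℕ →. ℕ)}

/-- `I ⊆ 𝒫` is an `ℛ`-monoid: it is a monoid under composition of partial functions,
and it contains all total computable functions. -/
structure IsRMonoid (I : Set (ℕ →. ℕ)) : Prop where
  subset_partial : I ⊆ partialComputable
  id_mem : PFun.id ℕ ∈ I
  comp_mem : ∀ f ∈ I, ∀ g ∈ I, f.comp g ∈ I
  total_subset : totalComputable ⊆ I

/-- A text is a total function into `ℕ ∪ {#}`; the pause symbol `#` is `none`. -/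
abbrev Text := ℕ → Option ℕ

/-- The content of a finite sequence over `ℕ ∪ {#}`: its elements other than `#`. -/
def seqContent (σ : List (Option ℕ)) : Set ℕ := {x | some x ∈ σ}

/-- The content of a text: its range without `#`. -/
def Text.content (T : Text) : Set ℕ := {x | ∃ n, T n = some x}

/-- The initial sequence `T[n] = (T(0), …, T(n-1))`. -/
def Text.initial (T : Text) (n : ℕ) : List (Option ℕ) := (List.range n).map T

/-- `Txt(L)`, the texts of `L`. -/
def textsOf (L : Set ℕ) : Set Text := {T | T.content = L}

/-- `Txt(S)`, the texts of the members of a family `S` of sets. -/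
def textsOfFamily (S : Set (Set ℕ)) : Set Text := ⋃ A ∈ S, textsOf A

/-- The Gold-style (full information) interaction operator:
`G(h, T)(i) = h(T[i])`, where finite sequences are coded as natural numbers. -/
def gold (h : ℕ →. ℕ) (T : Text) : ℕ →. ℕ := fun i => h (Encodable.encode (T.initial i))

/-- A learning restriction is a predicate on total learning sequences and texts. -/
abbrev Restriction := (ℕ → ℕ) → Text → Prop

/-- Explanatory learning. -/
def Ex : Restriction := fun p T =>
  ∃ n₀, ∀ n ≥ n₀, p n = p n₀ ∧ W (p n₀) = T.content

/-- Witness-based: every mind change is justified. -/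
def Wb : Restriction := fun p T =>
  ∀ n m, (∃ k, n ≤ k ∧ k ≤ m ∧ p n ≠ p k) →
    ((seqContent (T.initial m) ∩ W (p m)) \ W (p n)).Nonempty

/-- Target-cautious: no hypothesis properly overgeneralizes the content of the text. -/
def CautTar : Restriction := fun p T => ∀ n, ¬ (T.content ⊂ W (p n))

/-- The learner `h`, with full information, is defined on every initial sequence of `T`, and the
resulting (total) learning sequence satisfies the restriction `δ` on `T`. -/
def SatisfiesOn (δ : Restriction) (h : ℕ →. ℕ) (T : Text) : Prop :=
  ∃ p : ℕ → ℕ, gold h T = (p : ℕ →. ℕ) ∧ δ p T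

/-- The learner `h`, with full information, is defined on the text `T`. -/
def DefinedOn (h : ℕ →. ℕ) (T : Text) : Prop := ∀ i, (gold h T i).Dom

/-- `h` `TxtGδ`-learns the language `L`: on all texts of `L` it satisfies `δ`. -/
def TxtGLearns (δ : Restriction) (h : ℕ →. ℕ) (L : Set ℕ) : Prop :=
  ∀ T ∈ textsOf L, SatisfiesOn δ h T

end InductiveInference

open InductiveInference

namespace InductiveInference

open Nat.Partrec (Code)
open Nat.Partrec.Code (eval evaln)
open Encodable (encode)
open Denumerable (ofNat)
open Filter

/-! From (1) to (2) the same learner works: an overgeneralizing hypothesis can never be abandoned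
with a witness (`cautTar_of_wb_of_ex`). The construction is for the converse.

The new learner keeps a base sequence `σ` and conjectures `guardedSet c σ`. This set contains the
content of `σ` and follows the hypothesis of `c` on `σ` once that is seen to be consistent with `σ`;
but stage `s` is released only after `c` is seen to keep its mind on every extension of `σ` by a
sequence with code below `s` over the stage `s` approximation. Suppose the data `ρ` contain a
mind-changing sequence `τ` with code `t` and are not covered by stage `t`. A stage `s` covering `ρ`
has `s > t`, so `τ` blocks its release, and `ρ` has an element outside the conjecture
(`Refuted.not_subset`). Passing to the base `σ ++ τ ++ ρ` is therefore justified, and the witness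
stays in all later bases and conjectures (`wb_baseAt`).

On a text of a learned `L`, infinitely many such steps would produce a text of `L` on which `c` does
not converge (`eventually_baseAt_eq`). For the final base, either `c` never changes its mind over
`L`, so its hypothesis is correct and all stages are released; or the least mind change has some
code `t`, and stage `t`, which covers `L`, is released. Target-caution of `c` keeps the conjecture
inside `L` (`guardedSet_eq_of_learns`). -/

/-- `y` is a pause, or it is enumerated into `W e` within `s` steps. -/
def EnumeratedBy (s e : ℕ) (y : Option ℕ) : Prop :=
  y = none ∨ evaln s (ofNat Code e) (y.getD 0) ≠ none

/-- The stage `s` approximation of the hypothesis of the learner `c` on `σ`: the content of `σ`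
and, once the hypothesis is seen to be consistent with `σ`, what it enumerates in `s` steps. -/
def Approx (c : Code) (s : ℕ) (σ : List (Option ℕ)) (y : Option ℕ) : Prop :=
  y = none ∨ y ∈ σ ∨ (evaln s c (encode σ) ≠ none ∧
    (∀ z ∈ σ, EnumeratedBy s ((evaln s c (encode σ)).getD 0) z) ∧
    EnumeratedBy s ((evaln s c (encode σ)).getD 0) y)

/-- Within `k` steps, the learner `c` is seen not to change its mind from `σ` to any extension by
one of the first `s` sequences over the stage `s` approximation. -/
def StableAt (c : Code) (k s : ℕ) (σ : List (Option ℕ)) : Prop :=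
  ∀ t < s, (∀ y ∈ ofNat (List (Option ℕ)) t, Approx c s σ y) →
    evaln k c (encode σ) ≠ none ∧
      evaln k c (encode (σ ++ ofNat (List (Option ℕ)) t)) = evaln k c (encode σ)

/-- The data `ρ` justify giving up the hypothesis based on `σ`: the sequence with code `t` over `ρ`
leads to a mind change of `c`, and `ρ` is not covered by the stage `t` approximation. -/
def Refuted (c : Code) (σ ρ : List (Option ℕ)) (t : ℕ) : Prop :=
  (∀ y ∈ ofNat (List (Option ℕ)) t, y = none ∨ y ∈ ρ) ∧
  evaln ρ.length c (encode σ) ≠ none ∧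
  evaln ρ.length c (encode (σ ++ ofNat (List (Option ℕ)) t)) ≠ none ∧
  evaln ρ.length c (encode (σ ++ ofNat (List (Option ℕ)) t)) ≠ evaln ρ.length c (encode σ) ∧
  ¬ ∀ y ∈ ρ, Approx c t σ y

open Classical in
/-- The base sequence after seeing the data `ρ`, from the previous base sequence `σ`. -/
noncomputable def updateBase (c : Code) (ρ σ : List (Option ℕ)) : List (Option ℕ) :=
  -- Each `t` is the first component of infinitely many lengths, so every candidate is retried with
  -- ever more data and computation steps.
  if Refuted c σ ρ ρ.length.unpair.1 then
    σ ++ ofNat (List (Option ℕ)) ρ.length.unpair.1 ++ ρ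
  else σ

/-- The sequence on which the current hypothesis is based, after seeing `l`. -/
noncomputable def baseSeq (c : Code) (l : List (Option ℕ)) : List (Option ℕ) :=
  (l.foldl (fun a x => (a.1 ++ [x], updateBase c (a.1 ++ [x]) a.2)) (([], []) :
    List (Option ℕ) × List (Option ℕ))).2

/-! ### Computability -/

/-- All tests run `c` with a step bound, so the new learner is total even where `c` diverges. -/
theorem primrec_evaln_encode {α : Type*} [Primcodable α] (c : Code) {k : α → ℕ}
    {f : α → List (Option ℕ)} (hk : Primrec k) (hf : Primrec f) :
    Primrec fun a => evaln (k a) c (encode (f a)) :=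
  Code.primrec_evaln.comp ((hk.pair (.const c)).pair (Primrec.encode.comp hf))

theorem primrecPred_enumeratedBy : PrimrecPred fun a : (ℕ × ℕ) × Option ℕ =>
    EnumeratedBy a.1.1 a.1.2 a.2 := by
  refine PrimrecPred.or (Primrec.eq.comp .snd (.const none))
    (PrimrecPred.not (Primrec.eq.comp ?_ (.const none)))
  exact Code.primrec_evaln.comp (((Primrec.fst.comp .fst).pair
    ((Primrec.ofNat Code).comp (Primrec.snd.comp .fst))).pair
      (Primrec.option_getD.comp .snd (.const 0)))

theorem primrecPred_approx (c : Code) : PrimrecPred fun a : (ℕ × List (Option ℕ)) × Option ℕ =>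
    Approx c a.1.1 a.1.2 a.2 := by
  have hs : Primrec fun a : (ℕ × List (Option ℕ)) × Option ℕ => a.1.1 := Primrec.fst.comp .fst
  have hσ : Primrec fun a : (ℕ × List (Option ℕ)) × Option ℕ => a.1.2 := Primrec.snd.comp .fst
  have hv := primrec_evaln_encode c hs hσ
  have he := Primrec.option_getD.comp hv (Primrec.const 0)
  refine PrimrecPred.or (Primrec.eq.comp .snd (.const none)) (PrimrecPred.or ?_
    (PrimrecPred.and (PrimrecPred.not (Primrec.eq.comp hv (.const none)))
      (PrimrecPred.and ?_ (primrecPred_enumeratedBy.comp ((hs.pair he).pair .snd)))))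
  · have h : PrimrecRel fun (z y : Option ℕ) => z = y := Primrec.eq
    exact ((h.exists_mem_list).comp hσ Primrec.snd).of_eq (by simp)
  · have h : PrimrecRel fun (z : Option ℕ) (b : ℕ × ℕ) => EnumeratedBy b.1 b.2 z :=
      primrecPred_enumeratedBy.comp (Primrec.snd.pair .fst)
    exact (h.forall_mem_list).comp hσ (hs.pair he)

theorem primrecPred_forall_approx (c : Code) {α : Type*} [Primcodable α] {l : α → List (Option ℕ)}
    {s : α → ℕ} {f : α → List (Option ℕ)} (hl : Primrec l) (hs : Primrec s) (hf : Primrec f) :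
    PrimrecPred fun a => ∀ y ∈ l a, Approx c (s a) (f a) y := by
  have h : PrimrecRel fun (y : Option ℕ) (b : ℕ × List (Option ℕ)) => Approx c b.1 b.2 y :=
    (primrecPred_approx c).comp (Primrec.snd.pair .fst)
  exact h.forall_mem_list.comp hl (hs.pair hf)

theorem primrecPred_stableAt (c : Code) : PrimrecPred fun a : (ℕ × ℕ) × List (Option ℕ) =>
    StableAt c a.1.1 a.1.2 a.2 := by
  have h : PrimrecRel fun (t : ℕ) (a : (ℕ × ℕ) × List (Option ℕ)) =>
      (∀ y ∈ ofNat (List (Option ℕ)) t, Approx c a.1.2 a.2 y) →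
        evaln a.1.1 c (encode a.2) ≠ none ∧
          evaln a.1.1 c (encode (a.2 ++ ofNat (List (Option ℕ)) t)) =
            evaln a.1.1 c (encode a.2) := by
    have hτ : Primrec fun b : ℕ × ((ℕ × ℕ) × List (Option ℕ)) => ofNat (List (Option ℕ)) b.1 :=
      (Primrec.ofNat _).comp .fst
    have hσ : Primrec fun b : ℕ × ((ℕ × ℕ) × List (Option ℕ)) => b.2.2 := Primrec.snd.comp .snd
    have hk : Primrec fun b : ℕ × ((ℕ × ℕ) × List (Option ℕ)) => b.2.1.1 :=
      Primrec.fst.comp (Primrec.fst.comp .snd)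
    have hs : Primrec fun b : ℕ × ((ℕ × ℕ) × List (Option ℕ)) => b.2.1.2 :=
      Primrec.snd.comp (Primrec.fst.comp .snd)
    have hv := primrec_evaln_encode c hk hσ
    refine PrimrecPred.of_eq (PrimrecPred.or (primrecPred_forall_approx c hτ hs hσ).not
      (PrimrecPred.and (PrimrecPred.not (Primrec.eq.comp hv (.const none)))
        (Primrec.eq.comp (primrec_evaln_encode c hk (Primrec.list_append.comp hσ hτ)) hv)))
      fun b => imp_iff_not_or.symm
  exact (h.forall_mem_list.comp (Primrec.list_range.comp (Primrec.snd.comp .fst)) .id).of_eq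
    (by simp [StableAt])

theorem primrecPred_refuted (c : Code) :
    PrimrecPred fun a : (List (Option ℕ) × List (Option ℕ)) × ℕ => Refuted c a.1.1 a.1.2 a.2 := by
  have hσ : Primrec fun a : (List (Option ℕ) × List (Option ℕ)) × ℕ => a.1.1 :=
    Primrec.fst.comp .fst
  have hρ : Primrec fun a : (List (Option ℕ) × List (Option ℕ)) × ℕ => a.1.2 :=
    Primrec.snd.comp .fst
  have hτ : Primrec fun a : (List (Option ℕ) × List (Option ℕ)) × ℕ =>
      ofNat (List (Option ℕ)) a.2 := (Primrec.ofNat _).comp .snd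
  have hk := Primrec.list_length.comp hρ
  have hv := primrec_evaln_encode c hk hσ
  have hw := primrec_evaln_encode c hk (Primrec.list_append.comp hσ hτ)
  refine PrimrecPred.and ?_ (PrimrecPred.and (PrimrecPred.not (Primrec.eq.comp hv (.const none)))
    (PrimrecPred.and (PrimrecPred.not (Primrec.eq.comp hw (.const none)))
      (PrimrecPred.and (PrimrecPred.not (Primrec.eq.comp hw hv))
        (primrecPred_forall_approx c hρ .snd hσ).not)))
  have h₁ : PrimrecRel fun (z y : Option ℕ) => z = y := Primrec.eq
  have h₂ : PrimrecRel fun (y : Option ℕ) (ρ : List (Option ℕ)) => y = none ∨ y ∈ ρ :=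
    PrimrecPred.or (Primrec.eq.comp .fst (.const none))
      ((h₁.exists_mem_list.comp .snd .fst).of_eq (by simp))
  exact h₂.forall_mem_list.comp hτ hρ

theorem primrec_updateBase (c : Code) : Primrec₂ (updateBase c) := by
  classical
  have ht : Primrec fun a : List (Option ℕ) × List (Option ℕ) => a.1.length.unpair.1 :=
    Primrec.fst.comp (Primrec.unpair.comp (Primrec.list_length.comp .fst))
  refine Primrec.of_eq (Primrec.ite
    ((primrecPred_refuted c).comp ((Primrec.snd.pair .fst).pair ht))
    (Primrec.list_append.comp
      (Primrec.list_append.comp .snd ((Primrec.ofNat (List (Option ℕ))).comp ht)) .fst) .snd) ?_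
  intro a
  simp only [updateBase]

theorem primrec_baseSeq (c : Code) : Primrec (baseSeq c) := by
  have hρ : Primrec fun b : List (Option ℕ) ×
      ((List (Option ℕ) × List (Option ℕ)) × Option ℕ) => b.2.1.1 ++ [b.2.2] :=
    Primrec.list_concat.comp (Primrec.fst.comp (Primrec.fst.comp .snd)) (Primrec.snd.comp .snd)
  exact Primrec.snd.comp (Primrec.list_foldl .id (.const _)
    (hρ.pair ((primrec_updateBase c).comp hρ (Primrec.snd.comp (Primrec.fst.comp .snd)))).to₂)

/-- The set named by the hypothesis based on `σ` of the witness-based learner obtained from `c`. -/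
def guardedSet (c : Code) (σ : List (Option ℕ)) : Set ℕ :=
  {x | ∃ s k, Approx c s σ (some x) ∧ StableAt c k s σ}

theorem exists_index_guardedSet (c : Code) :
    ∃ g : List (Option ℕ) → ℕ, Computable g ∧ ∀ σ, W (g σ) = guardedSet c σ := by
  classical
  -- Here `a` codes the pair of `σ` and `x`, and `n` codes the stage `s` and time bound `k` to be
  -- searched for.
  let P : ℕ → ℕ → Prop := fun a n =>
    Approx c n.unpair.1 (ofNat (List (Option ℕ)) a.unpair.1) (some a.unpair.2) ∧
      StableAt c n.unpair.2 n.unpair.1 (ofNat (List (Option ℕ)) a.unpair.1)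
  have hP : PrimrecRel P := by
    have ha : Primrec fun b : ℕ × ℕ => b.1.unpair := Primrec.unpair.comp .fst
    have hn : Primrec fun b : ℕ × ℕ => b.2.unpair := Primrec.unpair.comp .snd
    have hσ : Primrec fun b : ℕ × ℕ => ofNat (List (Option ℕ)) b.1.unpair.1 :=
      (Primrec.ofNat _).comp (Primrec.fst.comp ha)
    exact PrimrecPred.and
      ((primrecPred_approx c).comp (((Primrec.fst.comp hn).pair hσ).pair
        (Primrec.option_some.comp (Primrec.snd.comp ha))))
      ((primrecPred_stableAt c).comp
        (((Primrec.snd.comp hn).pair (Primrec.fst.comp hn)).pair hσ))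
  have hF : Partrec fun a : ℕ => Nat.rfind fun n => (decide (P a n) : Part Bool) :=
    Partrec.rfind hP.decide.to_comp.partrec₂
  obtain ⟨d, hd⟩ := Code.exists_code.1 (Partrec.nat_iff.1 hF)
  refine ⟨fun σ => encode (Code.curry d (encode σ)), ?_, fun σ => ?_⟩
  · exact (Primrec.encode.comp (Code.primrec₂_curry.comp (.const d) Primrec.encode)).to_comp
  · ext x
    simp only [W, guardedSet, Denumerable.ofNat_encode, Set.mem_ofPred_eq, Code.eval_curry, hd,
      P, Nat.unpair_pair]
    constructor
    · rintro ⟨n, hn, -⟩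
      exact ⟨_, _, by simpa using hn⟩
    · rintro ⟨s, k, h⟩
      exact ⟨Nat.pair s k, by simpa using h, fun {_} _ => trivial⟩

theorem exists_computable_learner (c : Code) :
    ∃ (f : ℕ → ℕ) (g : List (Option ℕ) → ℕ), Computable f ∧ (∀ σ, W (g σ) = guardedSet c σ) ∧
      ∀ l : List (Option ℕ), f (encode l) = g (baseSeq c l) := by
  obtain ⟨g, hg, hW⟩ := exists_index_guardedSet c
  refine ⟨fun n => g (baseSeq c (ofNat (List (Option ℕ)) n)), g, ?_, hW, fun l => ?_⟩
  · exact hg.comp ((primrec_baseSeq c).to_comp.comp (Primrec.ofNat _).to_comp)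
  · simp only [Denumerable.ofNat_encode]

/-! ### Base sequences -/

theorem foldl_updateBase_fst (c : Code) (l : List (Option ℕ)) :
    (l.foldl (fun a x => (a.1 ++ [x], updateBase c (a.1 ++ [x]) a.2)) (([], []) :
      List (Option ℕ) × List (Option ℕ))).1 = l := by
  induction l using List.reverseRecOn with
  | nil => rfl
  | append_singleton l x ih => rw [List.foldl_concat]; simp only [ih]

theorem baseSeq_concat (c : Code) (l : List (Option ℕ)) (x : Option ℕ) :
    baseSeq c (l ++ [x]) = updateBase c (l ++ [x]) (baseSeq c l) := by
  simp only [baseSeq]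
  rw [List.foldl_concat]
  simp only [foldl_updateBase_fst]

theorem Text.initial_succ (T : Text) (n : ℕ) : T.initial (n + 1) = T.initial n ++ [T n] := by
  simp [Text.initial, List.range_succ]

@[simp] theorem Text.length_initial (T : Text) (n : ℕ) : (T.initial n).length = n := by
  simp [Text.initial]

theorem Text.mem_initial {T : Text} {n : ℕ} {y : Option ℕ} :
    y ∈ T.initial n ↔ ∃ i < n, T i = y := by
  simp [Text.initial]

theorem Text.initial_add (T : Text) (m n : ℕ) :
    T.initial (m + n) = T.initial m ++ (List.range n).map fun i => T (m + i) := by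
  simp [Text.initial, List.range_add, Function.comp_def]

theorem Text.initial_subset (T : Text) {m n : ℕ} (h : m ≤ n) : T.initial m ⊆ T.initial n := by
  intro y hy
  obtain ⟨i, hi, rfl⟩ := Text.mem_initial.1 hy
  exact Text.mem_initial.2 ⟨i, hi.trans_le h, rfl⟩

theorem Text.seqContent_initial_subset (T : Text) (n : ℕ) :
    seqContent (T.initial n) ⊆ T.content := by
  intro x hx
  obtain ⟨i, -, hi⟩ := Text.mem_initial.1 hx
  exact ⟨i, hi⟩

/-- The base sequence of the new learner along the text `T`. -/
noncomputable def baseAt (c : Code) (T : Text) (n : ℕ) : List (Option ℕ) := baseSeq c (T.initial n)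

theorem baseAt_zero (c : Code) (T : Text) : baseAt c T 0 = [] := rfl

theorem baseAt_succ_of_refuted {c : Code} {T : Text} {n : ℕ}
    (h : Refuted c (baseAt c T n) (T.initial (n + 1)) (n + 1).unpair.1) :
    baseAt c T (n + 1) = baseAt c T n ++ ofNat (List (Option ℕ)) (n + 1).unpair.1 ++
      T.initial (n + 1) := by
  rw [baseAt, Text.initial_succ, baseSeq_concat, ← Text.initial_succ, updateBase,
    Text.length_initial]
  exact if_pos h

theorem baseAt_succ_of_not_refuted {c : Code} {T : Text} {n : ℕ}
    (h : ¬ Refuted c (baseAt c T n) (T.initial (n + 1)) (n + 1).unpair.1) :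
    baseAt c T (n + 1) = baseAt c T n := by
  rw [baseAt, Text.initial_succ, baseSeq_concat, ← Text.initial_succ, updateBase,
    Text.length_initial]
  exact if_neg h

theorem baseAt_prefix_succ (c : Code) (T : Text) (n : ℕ) :
    baseAt c T n <+: baseAt c T (n + 1) := by
  by_cases h : Refuted c (baseAt c T n) (T.initial (n + 1)) (n + 1).unpair.1
  · rw [baseAt_succ_of_refuted h, List.append_assoc]
    exact List.prefix_append _ _
  · rw [baseAt_succ_of_not_refuted h]

theorem baseAt_prefix (c : Code) (T : Text) {m n : ℕ} (h : m ≤ n) :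
    baseAt c T m <+: baseAt c T n := by
  induction n, h using Nat.le_induction with
  | base => exact List.prefix_rfl
  | succ n _ ih => exact ih.trans (baseAt_prefix_succ c T n)

/-- Refuting sequences are taken over data already seen, so a base never leaves the content of the
text. -/
theorem mem_initial_of_mem_baseAt {c : Code} {T : Text} {n x : ℕ} (h : some x ∈ baseAt c T n) :
    some x ∈ T.initial n := by
  induction n with
  | zero => simp [baseAt_zero] at h
  | succ n ih =>
    have hsub := T.initial_subset n.le_succ
    by_cases hr : Refuted c (baseAt c T n) (T.initial (n + 1)) (n + 1).unpair.1
    · rw [baseAt_succ_of_refuted hr, List.mem_append, List.mem_append] at h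
      rcases h with (h | h) | h
      · exact hsub (ih h)
      · simpa using hr.1 _ h
      · exact h
    · rw [baseAt_succ_of_not_refuted hr] at h
      exact hsub (ih h)

/-! ### Approximations -/

theorem EnumeratedBy.mono {s s' e : ℕ} {y : Option ℕ} (h : s ≤ s') (hy : EnumeratedBy s e y) :
    EnumeratedBy s' e y := by
  refine hy.imp_right fun hv => ?_
  obtain ⟨v, hv⟩ := Option.ne_none_iff_exists'.1 hv
  rw [show evaln s' (ofNat Code e) (y.getD 0) = some v from Code.evaln_mono h hv]
  simp

/-- The default value in `Approx` is harmless, since it is guarded by the convergence test. -/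
theorem approx_iff {c : Code} {s : ℕ} {σ : List (Option ℕ)} {y : Option ℕ} :
    Approx c s σ y ↔ y = none ∨ y ∈ σ ∨ ∃ e, evaln s c (encode σ) = some e ∧
      (∀ z ∈ σ, EnumeratedBy s e z) ∧ EnumeratedBy s e y := by
  unfold Approx
  cases h : evaln s c (encode σ) <;> simp

theorem Approx.mono {c : Code} {s s' : ℕ} {σ : List (Option ℕ)} {y : Option ℕ} (h : s ≤ s')
    (hy : Approx c s σ y) : Approx c s' σ y := by
  rw [approx_iff] at hy ⊢
  rcases hy with hy | hy | ⟨e, he, hσ, hy⟩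
  · exact .inl hy
  · exact .inr (.inl hy)
  · exact .inr (.inr ⟨e, Code.evaln_mono h he, fun z hz => (hσ z hz).mono h, hy.mono h⟩)

theorem EnumeratedBy.mem_W {s e x : ℕ} (h : EnumeratedBy s e (some x)) : x ∈ W e := by
  rcases h with h | h
  · simp at h
  · obtain ⟨v, hv⟩ := Option.ne_none_iff_exists'.1 h
    exact Part.dom_iff_mem.2 ⟨v, Code.evaln_sound hv⟩

theorem eventually_evaln {c : Code} {n e : ℕ} (h : e ∈ eval c n) :
    ∀ᶠ k in atTop, evaln k c n = some e := by
  obtain ⟨k, hk⟩ := Code.evaln_complete.1 h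
  exact (eventually_ge_atTop k).mono fun k' h' => Code.evaln_mono h' hk

theorem eventually_enumeratedBy {e x : ℕ} (h : x ∈ W e) :
    ∀ᶠ s in atTop, EnumeratedBy s e (some x) := by
  obtain ⟨v, hv⟩ := Part.dom_iff_mem.1 h
  refine (eventually_evaln hv).mono fun s hs => .inr ?_
  rw [Option.getD_some, hs]
  simp

/-- The approximations only leave the content of `σ` if the hypothesis of `c` is consistent
with `σ`. -/
theorem Approx.mem_W {c : Code} {s : ℕ} {σ : List (Option ℕ)} {x : ℕ}
    (h : Approx c s σ (some x)) (hx : some x ∉ σ) :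
    ∃ e ∈ eval c (encode σ), seqContent σ ⊆ W e ∧ x ∈ W e := by
  rw [approx_iff] at h
  rcases h with h | h | ⟨e, he, hσ, h⟩
  · simp at h
  · exact absurd h hx
  · exact ⟨e, Code.evaln_sound he, fun z hz => (hσ _ hz).mem_W, h.mem_W⟩

theorem StableAt.mono {c : Code} {k k' s : ℕ} {σ : List (Option ℕ)} (h : StableAt c k s σ)
    (hk : k ≤ k') : StableAt c k' s σ := by
  intro t ht hA
  obtain ⟨h₁, h₂⟩ := h t ht hA
  obtain ⟨e, he⟩ := Option.ne_none_iff_exists'.1 h₁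
  rw [he] at h₂
  rw [show evaln k' c (encode σ) = some e from Code.evaln_mono hk he]
  exact ⟨by simp, Code.evaln_mono hk h₂⟩

/-- Stage `0` is vacuously stable, even if `c` diverges on `σ`. -/
theorem mem_guardedSet_of_mem {c : Code} {σ : List (Option ℕ)} {x : ℕ} (h : some x ∈ σ) :
    x ∈ guardedSet c σ :=
  ⟨0, 0, .inr (.inl h), fun t ht => absurd ht t.not_lt_zero⟩

theorem exists_stage_of_subset_guardedSet {c : Code} {σ ρ : List (Option ℕ)}
    (h : seqContent ρ ⊆ guardedSet c σ) :
    ∃ s k, (∀ y ∈ ρ, Approx c s σ y) ∧ StableAt c k s σ := by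
  induction ρ with
  | nil => exact ⟨0, 0, by simp, fun t ht => absurd ht t.not_lt_zero⟩
  | cons a ρ ih =>
    obtain ⟨s, k, hA, hS⟩ := ih fun x hx => h (List.mem_cons_of_mem _ hx)
    cases a with
    | none =>
      refine ⟨s, k, fun y hy => ?_, hS⟩
      rcases List.mem_cons.1 hy with rfl | hy
      exacts [.inl rfl, hA y hy]
    | some x =>
      obtain ⟨s', k', hx, hS'⟩ := h (List.mem_cons_self (a := some x))
      refine ⟨max s s', max k k', fun y hy => ?_, ?_⟩
      · rcases List.mem_cons.1 hy with rfl | hy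
        exacts [hx.mono (le_max_right _ _), (hA y hy).mono (le_max_left _ _)]
      -- Stability is not monotone in the stage, but the larger stage is one of the two, both known
      -- to be stable.
      · rcases le_total s s' with hle | hle
        · rw [max_eq_right hle]; exact hS'.mono (le_max_right _ _)
        · rw [max_eq_left hle]; exact hS.mono (le_max_left _ _)

theorem Refuted.not_subset {c : Code} {σ ρ : List (Option ℕ)} {t : ℕ} (h : Refuted c σ ρ t) :
    ¬ seqContent ρ ⊆ guardedSet c σ := by
  intro hsub
  obtain ⟨hτ, h₁, h₂, h₃, hA⟩ := h
  obtain ⟨s, k, hs, hS⟩ := exists_stage_of_subset_guardedSet hsub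
  -- Approximations grow with the stage, and `ρ` is not covered at stage `t`.
  have hts : t < s := by
    by_contra hle
    exact hA fun y hy => (hs y hy).mono (not_lt.1 hle)
  obtain ⟨hk₁, hk₂⟩ := hS t hts fun y hy => (hτ y hy).elim (fun h => .inl h) (hs y)
  obtain ⟨e, he⟩ := Option.ne_none_iff_exists'.1 hk₁
  obtain ⟨u, hu⟩ := Option.ne_none_iff_exists'.1 h₁
  obtain ⟨v, hv⟩ := Option.ne_none_iff_exists'.1 h₂
  rw [he] at hk₂
  rw [hu, hv] at h₃
  have hu' := Part.mem_unique (Code.evaln_sound hu) (Code.evaln_sound he)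
  have hv' := Part.mem_unique (Code.evaln_sound hv) (Code.evaln_sound hk₂)
  exact h₃ (by rw [hu', hv'])

/-! ### The new learner is witness-based on every text -/

theorem exists_refuted_of_baseAt_ne {c : Code} {T : Text} {n m : ℕ} (hnm : n ≤ m)
    (h : baseAt c T m ≠ baseAt c T n) :
    ∃ j, j < m ∧ baseAt c T j = baseAt c T n ∧
      Refuted c (baseAt c T j) (T.initial (j + 1)) (j + 1).unpair.1 := by
  induction m, hnm using Nat.le_induction with
  | base => exact absurd rfl h
  | succ m _ ih =>
    by_cases he : baseAt c T m = baseAt c T n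
    · refine ⟨m, m.lt_succ_self, he, ?_⟩
      by_contra hr
      exact h ((baseAt_succ_of_not_refuted hr).trans he)
    · obtain ⟨j, hj, h₁, h₂⟩ := ih he
      exact ⟨j, hj.trans m.lt_succ_self, h₁, h₂⟩

/-- The first refutation after `n` supplies the witness: it lies outside the old conjecture, and the
new base includes all data seen so far. -/
theorem wb_baseAt {c : Code} {g : List (Option ℕ) → ℕ} (hg : ∀ σ, W (g σ) = guardedSet c σ)
    (T : Text) : Wb (fun n => g (baseAt c T n)) T := by
  rintro n m ⟨k, hnk, hkm, hne⟩
  have hne' : baseAt c T k ≠ baseAt c T n := fun h => hne (by simp only [h])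
  obtain ⟨j, hjk, hjn, hr⟩ := exists_refuted_of_baseAt_ne hnk hne'
  obtain ⟨x, hx, hxn⟩ := Set.not_subset.1 hr.not_subset
  refine ⟨x, ⟨T.initial_subset (Nat.succ_le_of_lt (hjk.trans_le hkm)) hx, ?_⟩, ?_⟩
  · simp only [hg]
    refine mem_guardedSet_of_mem
      ((baseAt_prefix c T (Nat.succ_le_of_lt (hjk.trans_le hkm))).subset ?_)
    rw [Nat.succ_eq_add_one, baseAt_succ_of_refuted hr]
    exact List.mem_append_right _ hx
  · simpa only [hg, ← hjn] using hxn

/-! ### Texts with a given initial sequence -/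

/-- The text which starts with `σ` and continues with `T`. -/
def Text.prepend (σ : List (Option ℕ)) (T : Text) : Text := fun i =>
  if h : i < σ.length then σ[i] else T (i - σ.length)

theorem Text.initial_prepend_length (σ : List (Option ℕ)) (T : Text) :
    (T.prepend σ).initial σ.length = σ := by
  refine List.ext_getElem (by simp) fun i h₁ h₂ => ?_
  simp [Text.initial, Text.prepend, h₂]

theorem Text.initial_prepend_add (σ : List (Option ℕ)) (T : Text) (n : ℕ) :
    (T.prepend σ).initial (σ.length + n) = σ ++ T.initial n := by
  rw [Text.initial_add, Text.initial_prepend_length]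
  simp [Text.initial, Text.prepend]

theorem Text.content_prepend {σ : List (Option ℕ)} {T : Text} (h : seqContent σ ⊆ T.content) :
    (T.prepend σ).content = T.content := by
  ext x
  constructor
  · rintro ⟨i, hi⟩
    by_cases hlt : i < σ.length
    · rw [Text.prepend, dif_pos hlt] at hi
      exact h (show some x ∈ σ from hi ▸ List.getElem_mem hlt)
    · rw [Text.prepend, dif_neg hlt] at hi
      exact ⟨_, hi⟩
  · rintro ⟨i, hi⟩
    exact ⟨σ.length + i, by simp [Text.prepend, hi]⟩

/-- An unbounded chain of sequences has a limit text. -/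
theorem exists_text_of_chain (σ : ℕ → List (Option ℕ)) (hσ : ∀ m n, m ≤ n → σ m <+: σ n)
    (hlen : ∀ i, ∃ n, i < (σ n).length) :
    ∃ T : Text, (∀ n, T.initial (σ n).length = σ n) ∧
      T.content = ⋃ n, seqContent (σ n) := by
  choose N hN using hlen
  have key : ∀ n i (hi : i < (σ n).length), (σ (N i))[i]'(hN i) = (σ n)[i] := by
    intro n i hi
    rcases le_total n (N i) with h | h
    · exact ((hσ _ _ h).getElem hi).symm
    · exact (hσ _ _ h).getElem (hN i)
  refine ⟨fun i => (σ (N i))[i]'(hN i), fun n => ?_, ?_⟩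
  · refine List.ext_getElem (by simp) fun i h₁ h₂ => ?_
    simpa [Text.initial] using key n i h₂
  · ext x
    simp only [Text.content, seqContent, Set.mem_iUnion, Set.mem_ofPred_eq]
    constructor
    · rintro ⟨i, hi⟩
      exact ⟨N i, hi ▸ List.getElem_mem _⟩
    · rintro ⟨n, hn⟩
      obtain ⟨i, hi, he⟩ := List.getElem_of_mem hn
      exact ⟨i, (key n i hi).trans he⟩

/-! ### Consequences of learnability -/

section Learns

variable {c : Code} {L : Set ℕ}

theorem exists_value_of_learns
    (hL : TxtGLearns (fun p T => CautTar p T ∧ Ex p T) (eval c) L) {T : Text} (hT : T.content = L)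
    {σ : List (Option ℕ)} (hσ : seqContent σ ⊆ L) :
    ∃ e ∈ eval c (encode σ), ¬ L ⊂ W e := by
  have hc := Text.content_prepend (hT.symm ▸ hσ : seqContent σ ⊆ T.content)
  obtain ⟨p, hp, hcaut, -⟩ := hL (T.prepend σ) (hc.trans hT)
  refine ⟨p σ.length, ?_, ?_⟩
  · have := congrFun hp σ.length
    rw [gold, Text.initial_prepend_length] at this
    rw [this]
    exact Part.mem_some _
  · rw [← hT, ← hc]
    exact hcaut _

/-- A learner which does not change its mind on extensions of `σ` over `L` has identified `L`. -/
theorem W_eq_of_locking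
    (hL : TxtGLearns (fun p T => CautTar p T ∧ Ex p T) (eval c) L) {T : Text} (hT : T.content = L)
    {σ : List (Option ℕ)} (hσ : seqContent σ ⊆ L) {e : ℕ}
    (hlock : ∀ τ, seqContent τ ⊆ L → e ∈ eval c (encode (σ ++ τ))) : W e = L := by
  have hc := Text.content_prepend (hT.symm ▸ hσ : seqContent σ ⊆ T.content)
  obtain ⟨p, hp, -, n₀, hex⟩ := hL (T.prepend σ) (hc.trans hT)
  have hpe : p (σ.length + n₀) = e := by
    have := congrFun hp (σ.length + n₀)
    rw [gold, Text.initial_prepend_add] at this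
    refine Part.mem_unique (this ▸ Part.mem_some _)
      (hlock (T.initial n₀) (hT ▸ T.seqContent_initial_subset n₀))
  obtain ⟨h₁, h₂⟩ := hex (σ.length + n₀) (Nat.le_add_left _ _)
  rw [← hpe, h₁, h₂, hc, hT]

/-- The approximations based on a sequence over `L` do not overgeneralize. -/
theorem approx_subset_of_learns
    (hL : TxtGLearns (fun p T => CautTar p T ∧ Ex p T) (eval c) L) {T : Text} (hT : T.content = L)
    {σ : List (Option ℕ)} (hσ : seqContent σ ⊆ L)
    (hsub : ∀ x ∈ L, ∃ s, Approx c s σ (some x)) {s x : ℕ} (hx : Approx c s σ (some x)) :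
    x ∈ L := by
  by_contra hxL
  obtain ⟨e, he, hcons, hxe⟩ := hx.mem_W fun h => hxL (hσ h)
  obtain ⟨e', he', hcaut⟩ := exists_value_of_learns hL hT hσ
  obtain rfl := Part.mem_unique he he'
  refine hcaut ⟨fun z hz => ?_, fun h => hxL (h hxe)⟩
  -- Elements of `L` already in `σ` lie in `W e` only because of the consistency test; this makes `L
  -- ⊂ W e` and contradicts caution.
  by_cases hzσ : some z ∈ σ
  · exact hcons hzσ
  · obtain ⟨s', hs'⟩ := hsub z hz
    obtain ⟨e', he', -, hze⟩ := hs'.mem_W hzσ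
    rwa [Part.mem_unique he he']

/-- Finitely many convergent computations share a time bound `k`, which may exceed `s`; this is why
the two are separate. -/
theorem exists_stableAt {s e : ℕ} {σ : List (Option ℕ)} (he : e ∈ eval c (encode σ))
    (h : ∀ t < s, (∀ y ∈ ofNat (List (Option ℕ)) t, Approx c s σ y) →
      e ∈ eval c (encode (σ ++ ofNat (List (Option ℕ)) t))) : ∃ k, StableAt c k s σ := by
  have h₁ : ∀ᶠ k in atTop, ∀ t ∈ Set.Iio s,
      (∀ y ∈ ofNat (List (Option ℕ)) t, Approx c s σ y) →
      evaln k c (encode (σ ++ ofNat (List (Option ℕ)) t)) = some e := by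
    rw [eventually_all_finite (Set.finite_Iio s)]
    intro t ht
    by_cases hA : ∀ y ∈ ofNat (List (Option ℕ)) t, Approx c s σ y
    · exact (eventually_evaln (h t ht hA)).mono fun k hk _ => hk
    · exact Eventually.of_forall fun k hk => absurd hk hA
  obtain ⟨k, hk₁, hk₂⟩ := (h₁.and (eventually_evaln he)).exists
  refine ⟨k, fun t ht hA => ⟨by simp [hk₂], ?_⟩⟩
  rw [hk₁ t ht hA, hk₂]

theorem eventually_forall_enumeratedBy {e : ℕ} {σ : List (Option ℕ)} (h : seqContent σ ⊆ W e) :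
    ∀ᶠ s in atTop, ∀ z ∈ σ, EnumeratedBy s e z := by
  have := (eventually_all_finite (List.finite_toSet σ) (l := atTop)
    (p := fun z s => EnumeratedBy s e z)).2 fun z hz => ?_
  · exact this
  · cases z with
    | none => exact Eventually.of_forall fun _ => .inl rfl
    | some x => exact eventually_enumeratedBy (h hz)

theorem approx_of_mem_W {e x : ℕ} {σ : List (Option ℕ)} (he : e ∈ eval c (encode σ))
    (hσ : seqContent σ ⊆ W e) (hx : x ∈ W e) : ∃ s, Approx c s σ (some x) := by
  obtain ⟨s, ⟨h₁, h₂⟩, h₃⟩ := (((eventually_evaln he).and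
    (eventually_forall_enumeratedBy hσ)).and (eventually_enumeratedBy hx)).exists
  exact ⟨s, approx_iff.2 (.inr (.inr ⟨e, h₁, h₂, h₃⟩))⟩

theorem seqContent_subset_of_approx {L : Set ℕ} {σ τ : List (Option ℕ)} {s : ℕ}
    (h : ∀ x, Approx c s σ (some x) → x ∈ L) (hτ : ∀ y ∈ τ, Approx c s σ y) :
    seqContent τ ⊆ L :=
  fun _ hx => h _ (hτ _ hx)

/-- If every mind change of the learner on extensions of `σ` over `L` fails to refute the
hypothesis based on `σ`, then this hypothesis is correct for `L`. -/
theorem guardedSet_eq_of_learns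
    (hL : TxtGLearns (fun p T => CautTar p T ∧ Ex p T) (eval c) L) {T : Text} (hT : T.content = L)
    {σ : List (Option ℕ)} (hσ : seqContent σ ⊆ L) {e : ℕ} (he : e ∈ eval c (encode σ))
    (hcov : ∀ t, seqContent (ofNat (List (Option ℕ)) t) ⊆ L →
      e ∉ eval c (encode (σ ++ ofNat (List (Option ℕ)) t)) →
        ∀ x ∈ L, Approx c t σ (some x)) :
    guardedSet c σ = L := by
  classical
  suffices hsub : L ⊆ guardedSet c σ by
    refine Set.Subset.antisymm (fun x hx => ?_) hsub
    obtain ⟨s, k, hx, -⟩ := hx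
    exact approx_subset_of_learns hL hT hσ
      (fun z hz => let ⟨s, _, h, _⟩ := hsub hz; ⟨s, h⟩) hx
  by_cases hlock : ∃ t, seqContent (ofNat (List (Option ℕ)) t) ⊆ L ∧
      e ∉ eval c (encode (σ ++ ofNat (List (Option ℕ)) t))
  -- Stability at this stage only concerns strictly smaller codes, hence not the least mind change
  -- itself.
  · obtain ⟨ht, hne⟩ := Nat.find_spec hlock
    have hA := hcov _ ht hne
    obtain ⟨k, hk⟩ := exists_stableAt (s := Nat.find hlock) he fun t' ht' hA' => by
      by_contra hne'
      exact Nat.find_min hlock ht' ⟨seqContent_subset_of_approx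
        (fun x hx => approx_subset_of_learns hL hT hσ (fun z hz => ⟨_, hA z hz⟩) hx) hA', hne'⟩
    exact fun x hx => ⟨_, k, hA x hx, hk⟩
  · have hlock' : ∀ τ, seqContent τ ⊆ L → e ∈ eval c (encode (σ ++ τ)) := by
      intro τ hτ
      by_contra hne
      exact hlock ⟨encode τ, by simpa using hτ, by simpa using hne⟩
    have hW := W_eq_of_locking hL hT hσ hlock'
    have happ : ∀ x ∈ L, ∃ s, Approx c s σ (some x) := fun x hx =>
      approx_of_mem_W he (hW.symm ▸ hσ) (hW.symm ▸ hx)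
    intro x hx
    obtain ⟨s, hs⟩ := happ x hx
    obtain ⟨k, hk⟩ := exists_stableAt (s := s) he fun t _ hA => hlock' _
      (seqContent_subset_of_approx (fun x hx => approx_subset_of_learns hL hT hσ happ hx) hA)
    exact ⟨s, k, hs, hk⟩

/-! ### Convergence of the new learner -/

/-- Along a text of a learned language, the base sequence changes only finitely often. -/
theorem eventually_baseAt_eq
    (hL : TxtGLearns (fun p T => CautTar p T ∧ Ex p T) (eval c) L) {T : Text} (hT : T.content = L) :
    ∃ N, ∀ n ≥ N, baseAt c T n = baseAt c T N := by
  by_contra! hcon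
  have href : ∀ N, ∃ n ≥ N, Refuted c (baseAt c T n) (T.initial (n + 1)) (n + 1).unpair.1 := by
    intro N
    obtain ⟨n, hn, hne⟩ := hcon N
    by_contra! hno
    refine hne ?_
    clear hne
    induction n, hn using Nat.le_induction with
    | base => rfl
    | succ n hn ih => exact (baseAt_succ_of_not_refuted (hno n hn)).trans ih
  have hlen : ∀ i, ∃ n, i < (baseAt c T n).length := by
    intro i
    obtain ⟨n, hn, hr⟩ := href i
    refine ⟨n + 1, ?_⟩
    rw [baseAt_succ_of_refuted hr]
    simp only [List.length_append, Text.length_initial]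
    omega
  -- Each refutation appends all data seen so far, so the limit of the bases is a text of `L`.
  obtain ⟨T', hT', hcont⟩ := exists_text_of_chain (baseAt c T)
    (fun m n h => baseAt_prefix c T h) hlen
  have hT'L : T'.content = L := by
    rw [hcont]
    refine Set.Subset.antisymm (Set.iUnion_subset fun n x hx => ?_) fun x hx => ?_
    · exact hT ▸ T.seqContent_initial_subset n (mem_initial_of_mem_baseAt hx)
    · obtain ⟨i, hi⟩ : x ∈ T.content := hT ▸ hx
      obtain ⟨n, hn, hr⟩ := href i
      refine Set.mem_iUnion.2 ⟨n + 1, ?_⟩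
      rw [baseAt_succ_of_refuted hr]
      exact List.mem_append_right _ (Text.mem_initial.2 ⟨i, by omega, hi⟩)
  obtain ⟨p, hp, -, n₀, hex⟩ := hL T' hT'L
  obtain ⟨m, hm⟩ := hlen n₀
  obtain ⟨n, hn, hr⟩ := href m
  have hp' : ∀ σ, T'.initial σ.length = σ → ∀ k v, evaln k c (encode σ) = some v →
      p σ.length = v := by
    intro σ hσ k v hv
    have := congrFun hp σ.length
    rw [gold, hσ] at this
    exact Part.mem_unique (this ▸ Part.mem_some _) (Code.evaln_sound hv)
  have hl : n₀ ≤ (baseAt c T n).length := hm.le.trans (baseAt_prefix c T hn).length_le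
  obtain ⟨u, hu⟩ := Option.ne_none_iff_exists'.1 hr.2.1
  obtain ⟨v, hv⟩ := Option.ne_none_iff_exists'.1 hr.2.2.1
  -- The base and its mind-changing extension are both initial sequences of `T'`, beyond the point
  -- where `c` has converged.
  have hτ : T'.initial (baseAt c T n ++ ofNat (List (Option ℕ)) (n + 1).unpair.1).length =
      baseAt c T n ++ ofNat (List (Option ℕ)) (n + 1).unpair.1 := by
    have h₁ := hT' (n + 1)
    rw [baseAt_succ_of_refuted hr, List.length_append, Text.initial_add] at h₁
    exact List.append_inj_left h₁ (by simp)
  have h₁ := hp' _ (hT' n) _ _ hu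
  have h₂ := hp' _ hτ _ _ hv
  have h₃ := (hex _ hl).1
  have h₄ := (hex (baseAt c T n ++ ofNat (List (Option ℕ)) (n + 1).unpair.1).length (by
    rw [List.length_append]; omega)).1
  apply hr.2.2.2.1
  rw [hu, hv, ← h₁, ← h₂, h₃, h₄]

theorem ex_baseAt {g : List (Option ℕ) → ℕ} (hg : ∀ σ, W (g σ) = guardedSet c σ)
    (hL : TxtGLearns (fun p T => CautTar p T ∧ Ex p T) (eval c) L) {T : Text} (hT : T.content = L) :
    Ex (fun n => g (baseAt c T n)) T := by
  obtain ⟨N, hN⟩ := eventually_baseAt_eq hL hT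
  have hσ : seqContent (baseAt c T N) ⊆ L := fun x hx =>
    hT ▸ T.seqContent_initial_subset N (mem_initial_of_mem_baseAt hx)
  refine ⟨N, fun n hn => ⟨by simp only [hN n hn], ?_⟩⟩
  obtain ⟨e, he, -⟩ := exists_value_of_learns hL hT hσ
  rw [hg, hT]
  refine guardedSet_eq_of_learns hL hT hσ he fun t ht hne x hx => ?_
  obtain ⟨i, hi⟩ : x ∈ T.content := hT ▸ hx
  obtain ⟨v, hv, -⟩ := exists_value_of_learns hL hT
    (σ := baseAt c T N ++ ofNat (List (Option ℕ)) t) (by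
      intro z hz
      exact (List.mem_append.1 hz).elim (fun h => hσ h) fun h => ht h)
  have hseen : ∀ᶠ m in atTop, ∀ y ∈ ofNat (List (Option ℕ)) t, y = none ∨ y ∈ T.initial m := by
    refine (eventually_all_finite (List.finite_toSet (ofNat (List (Option ℕ)) t)) (l := atTop)
      (p := fun y m => y = none ∨ y ∈ T.initial m)).2 fun y hy => ?_
    cases y with
    | none => exact Eventually.of_forall fun _ => .inl rfl
    | some z =>
      obtain ⟨j, hj⟩ : z ∈ T.content := hT ▸ ht hy
      exact (eventually_gt_atTop j).mono fun m hm => .inr (Text.mem_initial.2 ⟨j, hm, hj⟩)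
  obtain ⟨M, hM⟩ := eventually_atTop.1 (((hseen.and (eventually_evaln he)).and
    (eventually_evaln hv)).and ((eventually_gt_atTop i).and (eventually_gt_atTop N)))
  -- At length `Nat.pair t M` the candidate `t` is tested, and this length is at least `M`, so data
  -- and time suffice.
  obtain ⟨⟨⟨h₁, h₂⟩, h₃⟩, h₄, h₅⟩ := hM _ (Nat.right_le_pair t M)
  obtain ⟨m, hm⟩ : ∃ m, Nat.pair t M = m + 1 := Nat.exists_eq_succ_of_ne_zero (by omega)
  have hunp : (m + 1).unpair.1 = t := by rw [← hm, Nat.unpair_pair]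
  rw [hm] at h₁ h₂ h₃ h₄ h₅
  have hstep : baseAt c T (m + 1) = baseAt c T m :=
    (hN _ h₅.le).trans (hN m (by omega)).symm
  -- A refutation would lengthen the base, which no longer changes.
  have hnr : ¬ Refuted c (baseAt c T m) (T.initial (m + 1)) (m + 1).unpair.1 := by
    intro hr
    have := congrArg List.length (hstep ▸ baseAt_succ_of_refuted hr)
    simp only [List.length_append, Text.length_initial] at this
    omega
  rw [hunp, hN m (by omega)] at hnr
  by_contra hx'
  refine hnr ⟨h₁, ?_, ?_, ?_, fun hall => hx' (hall _ (Text.mem_initial.2 ⟨i, h₄, hi⟩))⟩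
  · rw [Text.length_initial, h₂]; simp
  · rw [Text.length_initial, h₃]; simp
  · rw [Text.length_initial, h₂, h₃]
    rintro ⟨⟩
    exact hne hv

end Learns

/-! ### The equivalence -/

/-- Every partial computable learner can be replaced by a total one which is witness-based on all
texts and learns every language which the former learns target-cautiously. -/
theorem exists_total_witnessBased_learner {h : ℕ →. ℕ} (hh : Partrec h) :
    ∃ h' ∈ totalComputable, (∀ T : Text, SatisfiesOn Wb h' T) ∧
      ∀ L : Set ℕ, TxtGLearns (fun p T => CautTar p T ∧ Ex p T) h L →
        TxtGLearns (fun p T => Wb p T ∧ Ex p T) h' L := by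
  obtain ⟨c, rfl⟩ := Code.exists_code.1 (Partrec.nat_iff.1 hh)
  obtain ⟨f, g, hf, hg, hfg⟩ := exists_computable_learner c
  have hgold : ∀ T : Text, gold (f : ℕ →. ℕ) T = ((fun n => g (baseAt c T n) : ℕ → ℕ) : ℕ →. ℕ) :=
    fun T => funext fun n => congrArg Part.some (hfg (T.initial n))
  exact ⟨_, ⟨f, hf, rfl⟩, fun T => ⟨_, hgold T, wb_baseAt hg T⟩,
    fun L hL T hT => ⟨_, hgold T, wb_baseAt hg T, ex_baseAt hg hL hT⟩⟩

/-- A hypothesis properly containing the content differs from the final one, so some datum would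
have to lie outside it. -/
theorem cautTar_of_wb_of_ex {p : ℕ → ℕ} {T : Text} (hw : Wb p T) (he : Ex p T) : CautTar p T := by
  intro n hn
  obtain ⟨n₀, hex⟩ := he
  obtain ⟨h₁, h₂⟩ := hex (max n n₀) (le_max_right _ _)
  obtain ⟨x, ⟨hx, -⟩, hxn⟩ := hw n (max n n₀)
    ⟨max n n₀, le_max_left _ _, le_rfl, fun h => hn.ne (by rw [h, h₁, h₂])⟩
  exact hxn (hn.subset (T.seqContent_initial_subset _ hx))

theorem SatisfiesOn.definedOn {δ : Restriction} {h : ℕ →. ℕ} {T : Text} (hs : SatisfiesOn δ h T) :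
    DefinedOn h T := by
  obtain ⟨p, hp, -⟩ := hs
  intro i
  rw [hp]
  trivial

end InductiveInference

theorem mainTheorem2 :
    (∀ (I : Set (ℕ →. ℕ)) (S : Set (Set ℕ)) (𝓛 : Set (Set ℕ)),
      IsRMonoid I → IsLowerSet S → (∀ L ∈ 𝓛, REPred (fun x => x ∈ L)) →
      ((∃ h ∈ I, (∀ L ∈ 𝓛, TxtGLearns (fun p T => Wb p T ∧ Ex p T) h L) ∧
          ∀ T ∈ textsOfFamily S, SatisfiesOn Wb h T) ↔
        (∃ h ∈ I, (∀ L ∈ 𝓛, TxtGLearns (fun p T => CautTar p T ∧ Ex p T) h L) ∧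
          ∀ T ∈ textsOfFamily S, DefinedOn h T))) ∧
    (∀ h ∈ totalComputable, ∃ h' ∈ totalComputable,
      (∀ T : Text, SatisfiesOn Wb h' T) ∧
      ∀ L : Set ℕ, TxtGLearns (fun p T => CautTar p T ∧ Ex p T) h L →
        TxtGLearns (fun p T => Wb p T ∧ Ex p T) h' L) := by
  refine ⟨fun I S 𝓛 hI _ _ => ⟨?_, ?_⟩, ?_⟩
  · rintro ⟨h, hh, hL, hS⟩
    refine ⟨h, hh, fun L hLL T hT => ?_, fun T hT => (hS T hT).definedOn⟩
    obtain ⟨p, hp, hw, he⟩ := hL L hLL T hT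
    exact ⟨p, hp, cautTar_of_wb_of_ex hw he, he⟩
  · rintro ⟨h, hh, hL, -⟩
    obtain ⟨h', hh', hw, hL'⟩ := exists_total_witnessBased_learner (hI.subset_partial hh)
    exact ⟨h', hI.total_subset hh', fun L hLL => hL' L (hL L hLL), fun T _ => hw T⟩
  · rintro h ⟨f, hf, rfl⟩
    exact exists_total_witnessBased_learner hf.partrec
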